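/- Let $L^\infty(\mathbb{R})$ be the space of (classes of) complex-valued essentially bounded measurable functions on $\mathbb{R}$. A mean on $L^\infty(\mathbb{R})$ is a bounded linear functional $\Phi\in L^\infty(\mathbb{R})^*$ with $\Phi(\phi)\ge 0$ whenever $\phi\ge 0$ and $\Phi(1)=1$. It is topologically invariant if $\Phi(f*\phi)=\Phi(\phi)$ for every $\phi\in L^\infty(\mathbb{R})$ and every $f\in L^1(\mathbb{R})$ with $f\ge 0$ and $\int_{\mathbb{R}} f(x)\,dx=1$, where $(f*\phi)(x)=\int_{\mathbb{R}}\phi(x-t)f(t)\,dt$. A function $\phi\in L^\infty(\mathbb{R})$ almost converges to $\alpha\in\mathbb{C}$ if $\Phi(\phi)=\alpha$ for every topologically invariant mean $\Phi$ on $L^\infty(\mathbb{R})$. Let $H^\infty(\mathbb{R})\subseteq L^\infty(\mathbb{R})$ be the set of boundary functions $\phi(y)=\lim_{x\to 0^+}F(x+iy)$ (for almost every $y\in\mathbb{R}$) of bounded analytic functions $F$ on the right half plane $\{z\in\mathbb{C}:\operatorname{Re} z>0\}$. Corollary 4.1. Almost convergence is multiplicative on $H^\infty(\mathbb{R})$: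 if $\phi,\psi\in H^\infty(\mathbb{R})$ almost converge to $\alpha,\beta\in\mathbb{C}$ respectively, then $\phi\psi$ almost converges to $\alpha\beta$. -/

import Mathlib

open MeasureTheory Filter Topology
open scoped ENNReal ComplexOrder Convolution

noncomputable section

/-- `L^∞(ℝ)`: essentially bounded complex-valued functions on the line, modulo null sets. -/
abbrev LInf : Type := Lp ℂ ∞ (volume : Measure ℝ)

/-- `P(ℝ)`: the integrable `f ≥ 0` (a.e.) on the line with `∫ f = 1`. -/
def IsProbDensity (f : ℝ → ℝ) : Prop :=
  Integrable f ∧ (∀ᵐ x, 0 ≤ f x) ∧ ∫ x, f x = 1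

/-- The convolution `x ↦ ∫ f(t) φ(x - t) dt` of an integrable function with an essentially
bounded one is essentially bounded. -/
theorem memLp_top_convolution {f : ℝ → ℝ} (hf : Integrable f) (φ : LInf) :
    MemLp (f ⋆[ContinuousLinearMap.lsmul ℝ ℝ, volume] (φ : ℝ → ℂ)) ∞ volume := by
  have hbd : ∀ᵐ t : ℝ, ‖φ t‖ ≤ ‖φ‖ := by
    have h := ae_le_eLpNormEssSup (f := (φ : ℝ → ℂ)) (μ := volume)
    filter_upwards [h] with t ht
    rw [Lp.norm_def, eLpNorm_exponent_top]
    have hfin : eLpNormEssSup (φ : ℝ → ℂ) volume ≠ ∞ := by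
      have := Lp.eLpNorm_ne_top φ
      rwa [eLpNorm_exponent_top] at this
    rw [← toReal_enorm]
    exact ENNReal.toReal_mono hfin ht
  refine memLp_top_of_bound ?_ ((∫ t, ‖f t‖) * ‖φ‖) (Eventually.of_forall fun x => ?_)
  · exact (AEStronglyMeasurable.convolution_integrand (ContinuousLinearMap.lsmul ℝ ℝ)
      hf.aestronglyMeasurable (Lp.aestronglyMeasurable φ)).integral_prod_right'
  · rw [convolution_def, ← integral_mul_const]
    refine norm_integral_le_of_norm_le (hf.norm.mul_const _) ?_
    have hx := (Measure.measurePreserving_sub_left (volume : Measure ℝ) x).quasiMeasurePreserving.ae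
      hbd
    filter_upwards [hx] with t ht
    rw [ContinuousLinearMap.lsmul_apply, norm_smul]
    gcongr

/-- The convolution `(f * φ)(x) = ∫ φ(x - t) f(t) dt` as an element of `L^∞(ℝ)`. -/
def convLInf (f : ℝ → ℝ) (hf : Integrable f) (φ : LInf) : LInf :=
  (memLp_top_convolution hf φ).toLp (f ⋆[ContinuousLinearMap.lsmul ℝ ℝ, volume] (φ : ℝ → ℂ))

/-- The constant function `1` as an element of `L^∞(ℝ)`. -/
def oneLInf : LInf := (memLp_top_const (1 : ℂ)).toLp (fun _ : ℝ => (1 : ℂ))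

/-- A mean on `L^∞(ℝ)`: a bounded complex-linear functional that is positive and normalized.
In the order of `ℂ`, `0 ≤ z` says that `z` is a nonnegative real number. -/
def IsMean (Φ : StrongDual ℂ LInf) : Prop :=
  (∀ φ : LInf, (∀ᵐ x : ℝ, 0 ≤ φ x) → 0 ≤ Φ φ) ∧ Φ oneLInf = 1

/-- A topologically invariant mean: `Φ(f * φ) = Φ(φ)` for all `f ∈ P(ℝ)`, `φ ∈ L^∞(ℝ)`. -/
def IsTopInvariantMean (Φ : StrongDual ℂ LInf) : Prop :=
  IsMean Φ ∧ ∀ (f : ℝ → ℝ) (hf : IsProbDensity f) (φ : LInf), Φ (convLInf f hf.1 φ) = Φ φ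

/-- `φ` is almost convergent to `α`: every topologically invariant mean takes the value `α`
at `φ`. -/
def AlmostConvergesTo (φ : LInf) (α : ℂ) : Prop :=
  ∀ Φ : StrongDual ℂ LInf, IsTopInvariantMean Φ → Φ φ = α

/-- The Hardy class `H^∞` of the right half plane: `F` is analytic and bounded on `Re z > 0`
(its values elsewhere are irrelevant). -/
def IsHardyInf (F : ℂ → ℂ) : Prop :=
  DifferentiableOn ℂ F {z : ℂ | 0 < z.re} ∧ ∃ C : ℝ, ∀ z : ℂ, 0 < z.re → ‖F z‖ ≤ C

/-- `H^∞(ℝ) ⊆ L^∞(ℝ)`: the boundary functions `φ(y) = lim_{x → 0+} F(x + iy)` (for almost every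
`y`) of the functions `F` in `H^∞` of the right half plane. -/
def HInfBoundary : Set LInf :=
  {φ | ∃ F : ℂ → ℂ, IsHardyInf F ∧
    ∀ᵐ y : ℝ, Tendsto (fun x : ℝ => F ((x : ℂ) + (y : ℂ) * Complex.I)) (𝓝[>] 0) (𝓝 (φ y))}

/-- The pointwise (a.e.) product of two elements of `L^∞(ℝ)`. -/
def mulLInf (φ ψ : LInf) : LInf :=
  ((Lp.memLp ψ).mul (Lp.memLp φ) : MemLp ((φ : ℝ → ℂ) * (ψ : ℝ → ℂ)) ∞ volume).toLp
    ((φ : ℝ → ℂ) * (ψ : ℝ → ℂ))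

end

/-!
Almost convergence is governed by Poisson integrals: `φ` almost converges to `α` iff its Poisson
integral over the right half plane tends to `α` as `Re w → ∞`, uniformly in `Im w`. If it does,
convolutions of `φ` with Poisson kernels, on which a topologically invariant mean takes the same
value as on `φ`, converge in norm to the constant `α`. Conversely, the Poisson kernels become
asymptotically translation invariant in `L^1`, so every weak-* limit point of the functionals they
define is a topologically invariant mean. On `H^∞(ℝ)` the Poisson integral is the analytic extension
to the half plane, hence multiplicative.
-/

section LpTop

variable {X E : Type*} [MeasurableSpace X] {μ : Measure X} [NormedAddCommGroup E]

theorem ae_norm_le_norm_lpTop (φ : Lp E ∞ μ) : ∀ᵐ s ∂μ, ‖φ s‖ ≤ ‖φ‖ := by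
  have hfin : eLpNormEssSup φ μ ≠ ∞ := eLpNorm_exponent_top (f := φ) ▸ Lp.eLpNorm_ne_top φ
  filter_upwards [ae_le_eLpNormEssSup (f := φ) (μ := μ)] with s hs
  rw [Lp.norm_def, eLpNorm_exponent_top, ← toReal_enorm]
  exact ENNReal.toReal_mono hfin hs

theorem norm_lpTop_le_of_ae_norm_le {φ : Lp E ∞ μ} {C : ℝ} (hC : 0 ≤ C)
    (h : ∀ᵐ s ∂μ, ‖φ s‖ ≤ C) : ‖φ‖ ≤ C := by
  rw [Lp.norm_def, eLpNorm_exponent_top]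
  exact ENNReal.toReal_le_of_le_ofReal hC (eLpNormEssSup_le_of_ae_bound h)

variable [NormedSpace ℝ E]

theorem norm_integral_smul_le {p : X → ℝ} (hp : Integrable p μ) {g : X → E} {C : ℝ}
    (hC : ∀ᵐ s ∂μ, ‖g s‖ ≤ C) : ‖∫ s, p s • g s ∂μ‖ ≤ (∫ s, |p s| ∂μ) * C := by
  rw [← integral_mul_const]
  refine norm_integral_le_of_norm_le (hp.abs.mul_const C) ?_
  filter_upwards [hC] with s hs
  rw [norm_smul, Real.norm_eq_abs]
  gcongr

theorem integrable_smul_lpTop {p : X → ℝ} (hp : Integrable p μ) (φ : Lp E ∞ μ) :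
    Integrable (fun s => p s • φ s) μ :=
  hp.smul_bdd _ (Lp.aestronglyMeasurable φ) (ae_norm_le_norm_lpTop φ)

end LpTop

theorem integral_smul_convolution {E : Type*} [NormedAddCommGroup E] [NormedSpace ℝ E]
    {p f : ℝ → ℝ} (hp : Integrable p) (hf : Integrable f) {g : ℝ → E} {C : ℝ}
    (hg : AEStronglyMeasurable g) (hC : ∀ᵐ s, ‖g s‖ ≤ C) :
    ∫ s, p s • (f ⋆[ContinuousLinearMap.lsmul ℝ ℝ, volume] g) s =
      ∫ t, f t • ∫ s, p (s + t) • g s := by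
  have hsub : Measure.QuasiMeasurePreserving (fun q : ℝ × ℝ => q.1 - q.2)
      (volume.prod volume) volume := quasiMeasurePreserving_sub volume volume
  have hint : Integrable (Function.uncurry fun s t : ℝ => (p s * f t) • g (s - t))
      (volume.prod volume) :=
    (hp.mul_prod hf).smul_bdd _ (hg.comp_quasiMeasurePreserving hsub) (hsub.ae hC)
  calc ∫ s, p s • (f ⋆[ContinuousLinearMap.lsmul ℝ ℝ, volume] g) s
      = ∫ s, ∫ t, (p s * f t) • g (s - t) := by
        simp only [convolution_def, ContinuousLinearMap.lsmul_apply, ← integral_smul, smul_smul]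
    _ = ∫ t, ∫ s, (p s * f t) • g (s - t) := integral_integral_swap hint
    _ = ∫ t, ∫ s, (p (s + t) * f t) • g s := by
        congr with t
        rw [← integral_add_right_eq_self _ t]
        simp only [add_sub_cancel_right]
    _ = ∫ t, f t • ∫ s, p (s + t) • g s := by
        simp only [← integral_smul, smul_smul, mul_comm]

theorem coeFn_oneLInf : oneLInf =ᵐ[volume] fun _ => (1 : ℂ) :=
  MemLp.coeFn_toLp _

theorem coeFn_convLInf {f : ℝ → ℝ} (hf : Integrable f) (φ : LInf) :
    convLInf f hf φ =ᵐ[volume] f ⋆[ContinuousLinearMap.lsmul ℝ ℝ, volume] (φ : ℝ → ℂ) :=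
  MemLp.coeFn_toLp _

/-- Integration against an integrable weight `p`, as an element of the dual of `L^∞(ℝ)`; these
are the elements that come from `L^1(ℝ)`. -/
noncomputable def integralFunctional (p : ℝ → ℝ) (hp : Integrable p) : StrongDual ℂ LInf :=
  (ContinuousLinearMap.mul ℂ ℂ).lpPairing volume 1 ∞
    ((memLp_one_iff_integrable.2 hp.ofReal).toLp fun s => (p s : ℂ))

theorem integralFunctional_apply {p : ℝ → ℝ} (hp : Integrable p) (φ : LInf) :
    integralFunctional p hp φ = ∫ s, p s • φ s := by
  have hpC : Integrable fun s => (p s : ℂ) := hp.ofReal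
  rw [integralFunctional, ContinuousLinearMap.lpPairing_eq_integral]
  refine integral_congr_ae ?_
  filter_upwards [(memLp_one_iff_integrable.2 hpC).coeFn_toLp] with s hs
  rw [hs, ContinuousLinearMap.mul_apply', Complex.real_smul]

theorem norm_integralFunctional_le {p : ℝ → ℝ} (hp : Integrable p) :
    ‖integralFunctional p hp‖ ≤ ∫ s, |p s| := by
  refine ContinuousLinearMap.opNorm_le_bound _ (integral_nonneg fun s => abs_nonneg _) fun φ => ?_
  rw [integralFunctional_apply]
  exact norm_integral_smul_le hp (ae_norm_le_norm_lpTop φ)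

theorem integralFunctional_convLInf {p f : ℝ → ℝ} (hp : Integrable p) (hf : Integrable f)
    (φ : LInf) : integralFunctional p hp (convLInf f hf φ) =
      ∫ t, f t • integralFunctional (fun s => p (s + t)) (hp.comp_add_right t) φ := by
  simp only [integralFunctional_apply]
  rw [← integral_smul_convolution hp hf (Lp.aestronglyMeasurable φ) (ae_norm_le_norm_lpTop φ)]
  refine integral_congr_ae ?_
  filter_upwards [coeFn_convLInf hf φ] with s hs
  rw [hs]

theorem aestronglyMeasurable_integralFunctional_translate {p : ℝ → ℝ} (hp : Integrable p)
    (φ : LInf) : AEStronglyMeasurable fun t =>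
      integralFunctional (fun s => p (s + t)) (hp.comp_add_right t) φ := by
  simp only [integralFunctional_apply]
  exact ((hp.aestronglyMeasurable.comp_quasiMeasurePreserving
    (quasiMeasurePreserving_add_swap volume volume)).smul
    (Lp.aestronglyMeasurable φ).comp_snd).integral_prod_right'

theorem integralFunctional_convLInf_sub {p f : ℝ → ℝ} (hp : Integrable p) (hf : IsProbDensity f)
    (φ : LInf) : integralFunctional p hp (convLInf f hf.1 φ) - integralFunctional p hp φ =
      ∫ t, f t • (integralFunctional (fun s => p (s + t)) (hp.comp_add_right t) φ -
        integralFunctional p hp φ) := by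
  have hbound : ∀ t, ‖integralFunctional (fun s => p (s + t)) (hp.comp_add_right t) φ‖ ≤
      (∫ s, |p s|) * ‖φ‖ := fun t => by
    rw [← integral_add_right_eq_self (fun s => |p s|) t]
    exact ContinuousLinearMap.le_of_opNorm_le _ (norm_integralFunctional_le _) φ
  have htranslate : Integrable fun t =>
      f t • integralFunctional (fun s => p (s + t)) (hp.comp_add_right t) φ :=
    hf.1.smul_bdd _ (aestronglyMeasurable_integralFunctional_translate hp φ)
      (Eventually.of_forall hbound)
  simp only [smul_sub]
  rw [integralFunctional_convLInf hp hf.1, integral_sub htranslate (hf.1.smul_const _),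
    integral_smul_const, hf.2.2, one_smul]

theorem norm_integralFunctional_sub_le {p q : ℝ → ℝ} (hp : Integrable p) (hq : Integrable q)
    (φ : LInf) : ‖integralFunctional p hp φ - integralFunctional q hq φ‖ ≤
      (∫ s, |p s - q s|) * ‖φ‖ := by
  rw [integralFunctional_apply, integralFunctional_apply, ← integral_sub
    (integrable_smul_lpTop hp φ) (integrable_smul_lpTop hq φ)]
  simp only [← sub_smul]
  exact norm_integral_smul_le (hp.sub hq) (ae_norm_le_norm_lpTop φ)

namespace IsProbDensity

variable {p : ℝ → ℝ}

theorem integral_abs (hp : IsProbDensity p) : ∫ s, |p s| = 1 := by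
  rw [← hp.2.2]
  refine integral_congr_ae ?_
  filter_upwards [hp.2.1] with s hs using abs_of_nonneg hs

theorem comp_add_right (hp : IsProbDensity p) (t : ℝ) : IsProbDensity fun s => p (s + t) :=
  ⟨hp.1.comp_add_right t,
    (measurePreserving_add_right volume t).quasiMeasurePreserving.ae hp.2.1,
    (integral_add_right_eq_self p t).trans hp.2.2⟩

theorem integral_abs_sub_le {q : ℝ → ℝ} (hp : IsProbDensity p) (hq : IsProbDensity q) :
    ∫ s, |p s - q s| ≤ 2 :=
  calc ∫ s, |p s - q s| ≤ ∫ s, (|p s| + |q s|) :=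
        integral_mono (hp.1.sub hq.1).abs (hp.1.abs.add hq.1.abs) fun s => abs_sub _ _
    _ = 2 := by
        rw [integral_add hp.1.abs hq.1.abs, hp.integral_abs, hq.integral_abs, one_add_one_eq_two]

theorem isMean_integralFunctional (hp : IsProbDensity p) : IsMean (integralFunctional p hp.1) := by
  refine ⟨fun φ hφ => ?_, ?_⟩
  · rw [integralFunctional_apply]
    refine integral_nonneg_of_ae ?_
    filter_upwards [hp.2.1, hφ] with s hps hφs using smul_nonneg hps hφs
  · calc integralFunctional p hp.1 oneLInf = ∫ s, p s • (1 : ℂ) := by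
          rw [integralFunctional_apply]
          refine integral_congr_ae ?_
          filter_upwards [coeFn_oneLInf] with s hs
          rw [hs]
      _ = 1 := by rw [integral_smul_const, hp.2.2, one_smul]

end IsProbDensity
theorem exists_tendsto_of_eventually_norm_le {𝕜 E ι : Type*} [NontriviallyNormedField 𝕜]
    [ProperSpace 𝕜] [SeminormedAddCommGroup E] [NormedSpace 𝕜 E] (u : Ultrafilter ι)
    {Ψ : ι → StrongDual 𝕜 E} {C : ℝ} (hΨ : ∀ᶠ i in u, ‖Ψ i‖ ≤ C) :
    ∃ Φ : StrongDual 𝕜 E, ∀ v, Tendsto (fun i => Ψ i v) u (𝓝 (Φ v)) := by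
  have hball : ∀ᶠ i in u, StrongDual.toWeakDual (Ψ i) ∈
      WeakDual.toStrongDual ⁻¹' Metric.closedBall (0 : StrongDual 𝕜 E) C := by
    simpa using hΨ
  obtain ⟨Φ, -, hΦ⟩ := (WeakDual.isCompact_closedBall (0 : StrongDual 𝕜 E) C).ultrafilter_le_nhds
    (u.map fun i => StrongDual.toWeakDual (Ψ i)) (le_principal_iff.2 hball)
  exact ⟨WeakDual.toStrongDual Φ, fun v => ((WeakDual.eval_continuous v).tendsto Φ).comp hΦ⟩

theorem isTopInvariantMean_of_tendsto {ι : Type*} {l : Filter ι} [l.NeBot]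
    {Ψ : ι → StrongDual ℂ LInf} {Φ : StrongDual ℂ LInf} (hmean : ∀ᶠ i in l, IsMean (Ψ i))
    (hinv : ∀ (f : ℝ → ℝ) (hf : IsProbDensity f) (φ : LInf),
      Tendsto (fun i => Ψ i (convLInf f hf.1 φ) - Ψ i φ) l (𝓝 0))
    (hΦ : ∀ φ, Tendsto (fun i => Ψ i φ) l (𝓝 (Φ φ))) : IsTopInvariantMean Φ := by
  refine ⟨⟨fun φ hφ => ?_, ?_⟩, fun f hf φ => ?_⟩
  · exact ge_of_tendsto (hΦ φ) (hmean.mono fun i hi => hi.1 φ hφ)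
  · exact tendsto_nhds_unique_of_eventuallyEq (hΦ oneLInf) tendsto_const_nhds
      (hmean.mono fun i hi => hi.2)
  · exact sub_eq_zero.1 (tendsto_nhds_unique ((hΦ _).sub (hΦ φ)) (hinv f hf φ))

/-- Reiter's condition for a family of integrable weights: eventually along `l` they are
probability densities, and asymptotically translation invariant in `L^1(ℝ)`. Integrability of every
member makes `integralFunctional` available along the whole family. -/
structure IsReiterFamily {ι : Type*} (p : ι → ℝ → ℝ) (l : Filter ι) : Prop where
  integrable : ∀ i, Integrable (p i)
  eventually_isProbDensity : ∀ᶠ i in l, IsProbDensity (p i)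
  tendsto_integral_abs_translate_sub :
    ∀ t, Tendsto (fun i => ∫ s, |p i (s + t) - p i s|) l (𝓝 0)

namespace IsReiterFamily

variable {ι : Type*} {p : ι → ℝ → ℝ} {l : Filter ι}

theorem tendsto_integralFunctional_convLInf_sub [l.IsCountablyGenerated] (hp : IsReiterFamily p l)
    {f : ℝ → ℝ} (hf : IsProbDensity f) (φ : LInf) :
    Tendsto (fun i => integralFunctional (p i) (hp.integrable i) (convLInf f hf.1 φ) -
      integralFunctional (p i) (hp.integrable i) φ) l (𝓝 0) := by
  simp only [integralFunctional_convLInf_sub (hp.integrable _) hf]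
  rw [← integral_zero ℝ ℂ]
  refine tendsto_integral_filter_of_dominated_convergence (fun t => |f t| * (2 * ‖φ‖))
    (Eventually.of_forall fun i => ?_) ?_ (hf.1.abs.mul_const _) (Eventually.of_forall fun t => ?_)
  · exact hf.1.aestronglyMeasurable.smul
      ((aestronglyMeasurable_integralFunctional_translate (hp.integrable i) φ).sub
        aestronglyMeasurable_const)
  · filter_upwards [hp.eventually_isProbDensity] with i hi
    refine Eventually.of_forall fun t => ?_
    rw [norm_smul, Real.norm_eq_abs]
    gcongr
    refine (norm_integralFunctional_sub_le _ _ φ).trans ?_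
    gcongr
    exact (hi.comp_add_right t).integral_abs_sub_le hi
  · have hzero : Tendsto (fun i => (∫ s, |p i (s + t) - p i s|) * ‖φ‖) l (𝓝 0) := by
      simpa only [zero_mul] using (hp.tendsto_integral_abs_translate_sub t).mul_const ‖φ‖
    simpa only [smul_zero] using (squeeze_zero_norm
      (fun i => norm_integralFunctional_sub_le _ (hp.integrable i) φ) hzero).const_smul (f t)

theorem exists_isTopInvariantMean_tendsto [l.IsCountablyGenerated] (hp : IsReiterFamily p l)
    (u : Ultrafilter ι) (hu : u ≤ l) :
    ∃ Φ, IsTopInvariantMean Φ ∧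
      ∀ φ, Tendsto (fun i => integralFunctional (p i) (hp.integrable i) φ) u (𝓝 (Φ φ)) := by
  have hnorm : ∀ᶠ i in l, ‖integralFunctional (p i) (hp.integrable i)‖ ≤ 1 :=
    hp.eventually_isProbDensity.mono fun i hi =>
      (norm_integralFunctional_le _).trans_eq hi.integral_abs
  obtain ⟨Φ, hΦ⟩ := exists_tendsto_of_eventually_norm_le u (hnorm.filter_mono hu)
  refine ⟨Φ, isTopInvariantMean_of_tendsto ?_ (fun f hf φ => ?_) hΦ, hΦ⟩
  · exact (hp.eventually_isProbDensity.mono fun i hi =>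
      hi.isMean_integralFunctional).filter_mono hu
  · exact (hp.tendsto_integralFunctional_convLInf_sub hf φ).mono_left hu

end IsReiterFamily

theorem AlmostConvergesTo.tendsto_integral {φ : LInf} {α : ℂ} (hφ : AlmostConvergesTo φ α)
    {ι : Type*} {p : ι → ℝ → ℝ} {l : Filter ι} [l.IsCountablyGenerated] (hp : IsReiterFamily p l) :
    Tendsto (fun i => ∫ s, p i s • φ s) l (𝓝 α) := by
  refine (tendsto_iff_ultrafilter _ _ _).2 fun u hu => ?_
  obtain ⟨Φ, hΦ, hlim⟩ := hp.exists_isTopInvariantMean_tendsto u hu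
  simpa only [integralFunctional_apply, hφ Φ hΦ] using hlim φ

theorem almostConvergesTo_of_tendsto_convLInf {ι : Type*} {p : ι → ℝ → ℝ} {l : Filter ι} [l.NeBot]
    (hp : ∀ i, Integrable (p i)) (hdensity : ∀ᶠ i in l, IsProbDensity (p i)) {φ : LInf} {α : ℂ}
    (h : Tendsto (fun i => convLInf (p i) (hp i) φ) l (𝓝 (α • oneLInf))) :
    AlmostConvergesTo φ α := by
  intro Φ hΦ
  have hlim : Tendsto (fun i => Φ (convLInf (p i) (hp i) φ)) l (𝓝 α) := by
    have hΦα : Φ (α • oneLInf) = α := by rw [map_smul, hΦ.1.2, smul_eq_mul, mul_one]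
    exact hΦα ▸ (Φ.continuous.tendsto _).comp h
  refine tendsto_nhds_unique_of_eventuallyEq tendsto_const_nhds hlim ?_
  filter_upwards [hdensity] with i hi using (hΦ.2 (p i) hi φ).symm

section Poisson

variable {E : Type*} [NormedAddCommGroup E] [NormedSpace ℝ E]

/-- The Poisson kernel of the right half plane at the point `w`, which is the Cauchy density with
location `Im w` and scale `Re w`. The truncation `toNNReal` makes it vanish when `Re w ≤ 0`. -/
noncomputable def halfPlanePoisson (w : ℂ) : ℝ → ℝ :=
  ProbabilityTheory.cauchyPDFReal w.im w.re.toNNReal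

theorem integrable_halfPlanePoisson (w : ℂ) : Integrable (halfPlanePoisson w) :=
  ProbabilityTheory.integrable_cauchyPDFReal _

theorem halfPlanePoisson_apply {w : ℂ} (hw : 0 < w.re) (s : ℝ) :
    halfPlanePoisson w s = Real.pi⁻¹ * w.re * ((s - w.im) ^ 2 + w.re ^ 2)⁻¹ := by
  rw [halfPlanePoisson, ProbabilityTheory.cauchyPDFReal_def, Real.coe_toNNReal _ hw.le]

theorem isProbDensity_halfPlanePoisson {w : ℂ} (hw : 0 < w.re) :
    IsProbDensity (halfPlanePoisson w) :=
  have hscale : w.re.toNNReal ≠ 0 := (Real.toNNReal_pos.2 hw).ne'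
  ⟨integrable_halfPlanePoisson w,
    Eventually.of_forall fun s => (ProbabilityTheory.cauchyPDF_pos _ hscale s).le,
    ProbabilityTheory.integral_cauchyPDFReal_eq_one _ hscale⟩

theorem abs_inv_sq_add_sq_sub_le {x : ℝ} (hx : 0 < x) (a b : ℝ) :
    |(a ^ 2 + x ^ 2)⁻¹ - (b ^ 2 + x ^ 2)⁻¹| ≤
      |a - b| / (2 * x) * ((a ^ 2 + x ^ 2)⁻¹ + (b ^ 2 + x ^ 2)⁻¹) := by
  have ha : 0 < a ^ 2 + x ^ 2 := by positivity
  have hb : 0 < b ^ 2 + x ^ 2 := by positivity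
  have hamgm : |a + b| * (2 * x) ≤ (a ^ 2 + x ^ 2) + (b ^ 2 + x ^ 2) := by
    nlinarith [sq_nonneg (|a| - x), sq_nonneg (|b| - x), abs_add_le a b, sq_abs a, sq_abs b]
  calc |(a ^ 2 + x ^ 2)⁻¹ - (b ^ 2 + x ^ 2)⁻¹|
      = |a - b| * |a + b| / ((a ^ 2 + x ^ 2) * (b ^ 2 + x ^ 2)) := by
        rw [inv_sub_inv ha.ne' hb.ne', abs_div, abs_of_pos (mul_pos ha hb),
          add_sub_add_right_eq_sub, sq_sub_sq, abs_mul, abs_sub_comm, add_comm b, mul_comm |a + b|]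
    _ ≤ |a - b| * (((a ^ 2 + x ^ 2) + (b ^ 2 + x ^ 2)) / (2 * x)) /
          ((a ^ 2 + x ^ 2) * (b ^ 2 + x ^ 2)) := by
        gcongr
        exact (le_div_iff₀ (by positivity)).2 hamgm
    _ = |a - b| / (2 * x) * ((a ^ 2 + x ^ 2)⁻¹ + (b ^ 2 + x ^ 2)⁻¹) := by
        field_simp
        ring

theorem abs_halfPlanePoisson_translate_sub_le {w : ℂ} (hw : 0 < w.re) (s t : ℝ) :
    |halfPlanePoisson w (s + t) - halfPlanePoisson w s| ≤
      |t| / (2 * w.re) * (halfPlanePoisson w (s + t) + halfPlanePoisson w s) := by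
  have hpos : 0 < Real.pi⁻¹ * w.re := by positivity
  have h := abs_inv_sq_add_sq_sub_le hw (s + t - w.im) (s - w.im)
  rw [sub_sub_sub_cancel_right, add_sub_cancel_left] at h
  simp only [halfPlanePoisson_apply hw]
  rw [← mul_sub, ← mul_add, abs_mul, abs_of_pos hpos, mul_left_comm]
  gcongr

theorem integral_abs_halfPlanePoisson_translate_sub_le {w : ℂ} (hw : 0 < w.re) (t : ℝ) :
    ∫ s, |halfPlanePoisson w (s + t) - halfPlanePoisson w s| ≤ |t| / w.re := by
  have hp := isProbDensity_halfPlanePoisson hw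
  have hpt := hp.comp_add_right t
  calc ∫ s, |halfPlanePoisson w (s + t) - halfPlanePoisson w s|
      ≤ ∫ s, |t| / (2 * w.re) * (halfPlanePoisson w (s + t) + halfPlanePoisson w s) :=
        integral_mono (hpt.1.sub hp.1).abs ((hpt.1.add hp.1).const_mul _)
          fun s => abs_halfPlanePoisson_translate_sub_le hw s t
    _ = |t| / w.re := by
        rw [integral_const_mul, integral_add hpt.1 hp.1, hpt.2.2, hp.2.2]
        field_simp
        ring

theorem isReiterFamily_halfPlanePoisson :
    IsReiterFamily halfPlanePoisson (comap Complex.re atTop) where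
  integrable := integrable_halfPlanePoisson
  eventually_isProbDensity :=
    (tendsto_comap.eventually_gt_atTop 0).mono fun _ => isProbDensity_halfPlanePoisson
  tendsto_integral_abs_translate_sub t :=
    squeeze_zero' (Eventually.of_forall fun _ => integral_nonneg fun _ => abs_nonneg _)
      ((tendsto_comap.eventually_gt_atTop 0).mono fun _ hw =>
        integral_abs_halfPlanePoisson_translate_sub_le hw t)
      (tendsto_comap.const_div_atTop |t|)

/-- The Poisson integral at the point `w` of a function `g` on the imaginary axis. -/
noncomputable def poissonIntegral (w : ℂ) (g : ℝ → E) : E :=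
  ∫ s, halfPlanePoisson w s • g s

theorem poissonIntegral_congr_ae (w : ℂ) {g h : ℝ → E} (hgh : g =ᵐ[volume] h) :
    poissonIntegral w g = poissonIntegral w h :=
  integral_congr_ae (hgh.mono fun s hs => congrArg (halfPlanePoisson w s • ·) hs)

theorem halfPlanePoisson_convolution (x y : ℝ) (g : ℝ → E) :
    (halfPlanePoisson x ⋆[ContinuousLinearMap.lsmul ℝ ℝ, volume] g) y =
      poissonIntegral (x + y * Complex.I) g := by
  rw [convolution_lsmul_swap, poissonIntegral]
  congr with s
  simp [halfPlanePoisson, ProbabilityTheory.cauchyPDFReal_def, sub_sq_comm y s]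

theorem norm_convLInf_halfPlanePoisson_sub_le {x : ℝ} {φ : LInf} {α : ℂ} {C : ℝ} (hC : 0 ≤ C)
    (h : ∀ y : ℝ, ‖poissonIntegral (x + y * Complex.I) φ - α‖ ≤ C) :
    ‖convLInf (halfPlanePoisson x) (integrable_halfPlanePoisson x) φ - α • oneLInf‖ ≤ C := by
  refine norm_lpTop_le_of_ae_norm_le hC ?_
  filter_upwards [Lp.coeFn_sub (convLInf (halfPlanePoisson x) (integrable_halfPlanePoisson x) φ)
    (α • oneLInf), Lp.coeFn_smul α oneLInf, coeFn_oneLInf,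
    coeFn_convLInf (integrable_halfPlanePoisson x) φ] with y hsub hsmul hone hconv
  rw [hsub, Pi.sub_apply, hsmul, Pi.smul_apply, hone, hconv, halfPlanePoisson_convolution,
    smul_eq_mul, mul_one]
  exact h y

/-- The filter `comap Complex.re atTop` means `Re w → ∞`, uniformly in `Im w`. -/
theorem almostConvergesTo_iff_tendsto_poissonIntegral {φ : LInf} {α : ℂ} :
    AlmostConvergesTo φ α ↔
      Tendsto (fun w => poissonIntegral w φ) (comap Complex.re atTop) (𝓝 α) := by
  refine ⟨fun hφ => hφ.tendsto_integral isReiterFamily_halfPlanePoisson, fun h => ?_⟩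
  refine almostConvergesTo_of_tendsto_convLInf (l := atTop) (p := fun x : ℝ => halfPlanePoisson x)
    (fun x => integrable_halfPlanePoisson x)
    ((eventually_gt_atTop 0).mono fun x hx => isProbDensity_halfPlanePoisson hx) ?_
  rw [Metric.tendsto_nhds] at h ⊢
  intro ε hε
  filter_upwards [eventually_comap.1 (h (ε / 2) (half_pos hε))] with x hx
  rw [dist_eq_norm]
  refine (norm_convLInf_halfPlanePoisson_sub_le (half_pos hε).le fun y => ?_).trans_lt
    (half_lt_self hε)
  rw [← dist_eq_norm]
  exact (hx (x + y * Complex.I) (by simp)).le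

end Poisson

section PoissonFormula

open scoped ComplexConjugate

variable {E : Type*} [NormedAddCommGroup E] [NormedSpace ℂ E]

theorem norm_intervalIntegral_left_side_le {H : ℂ → E} {a b c d M : ℝ}
    (hab : a ≤ b) (hcd : c ≤ d) (hcont : ContinuousOn H (Set.Icc a b ×ℂ Set.Icc c d))
    (hdiff : DifferentiableOn ℂ H (Set.Ioo a b ×ℂ Set.Ioo c d))
    (hM : ∀ w ∈ Set.Icc a b ×ℂ Set.Icc c d, w.re = b ∨ w.im = c ∨ w.im = d → ‖H w‖ ≤ M) :
    ‖∫ t in c..d, H (a + t * Complex.I)‖ ≤ M * (2 * (b - a) + (d - c)) := by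
  have hzero := Complex.integral_boundary_rect_eq_zero_of_continuousOn_of_differentiableOn H
    ⟨a, c⟩ ⟨b, d⟩ (by simpa only [Set.uIcc_of_le hab, Set.uIcc_of_le hcd] using hcont)
    (by simpa only [min_eq_left hab, max_eq_right hab, min_eq_left hcd, max_eq_right hcd]
      using hdiff)
  have hhorizontal : ∀ e : ℝ, e = c ∨ e = d →
      ‖∫ x in a..b, H (x + e * Complex.I)‖ ≤ M * (b - a) := fun e he => by
    have heIcc : e ∈ Set.Icc c d := by rcases he with rfl | rfl <;> simp [hcd]
    rw [← abs_of_nonneg (sub_nonneg.2 hab)]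
    refine intervalIntegral.norm_integral_le_of_norm_le_const fun x hx => hM _ ?_ ?_
    · rw [Set.uIoc_of_le hab] at hx
      simpa [Complex.mem_reProdIm] using ⟨⟨hx.1.le, hx.2⟩, heIcc⟩
    · simpa using Or.inr he
  have hright : ‖∫ t in c..d, H (b + t * Complex.I)‖ ≤ M * (d - c) := by
    rw [← abs_of_nonneg (sub_nonneg.2 hcd)]
    refine intervalIntegral.norm_integral_le_of_norm_le_const fun t ht => hM _ ?_ (by simp)
    rw [Set.uIoc_of_le hcd] at ht
    simpa [Complex.mem_reProdIm] using ⟨hab, ht.1.le, ht.2⟩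
  calc ‖∫ t in c..d, H (a + t * Complex.I)‖
      = ‖Complex.I • ∫ t in c..d, H (a + t * Complex.I)‖ := by
        rw [norm_smul, Complex.norm_I, one_mul]
    _ = ‖(∫ x in a..b, H (x + c * Complex.I)) - (∫ x in a..b, H (x + d * Complex.I)) +
          Complex.I • ∫ t in c..d, H (b + t * Complex.I)‖ := by
        rw [sub_eq_zero.1 hzero]
    _ ≤ M * (b - a) + M * (b - a) + M * (d - c) := by
        refine norm_add_le_of_le (norm_sub_le_of_le (hhorizontal c (.inl rfl))
          (hhorizontal d (.inr rfl))) ?_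
        rwa [norm_smul, Complex.norm_I, one_mul]
    _ = M * (2 * (b - a) + (d - c)) := by ring

/-- The quotient `(G w - G w₀) / ((w - w₀) (w + conj w₀))`, with its removable singularity at `w₀`
filled in. On the imaginary axis it is a constant multiple of the Poisson kernel at `w₀` times
`G - G w₀`; unlike the Cauchy quotient, it decays quadratically when `G` is bounded. -/
noncomputable def poissonQuotient (G : ℂ → E) (w₀ w : ℂ) : E :=
  (w + conj w₀)⁻¹ • dslope G w₀ w

theorem diffContOnCl_poissonQuotient [CompleteSpace E] {G : ℂ → E}
    (hG : DiffContOnCl ℂ G {z | 0 < z.re}) {w₀ : ℂ} (hw₀ : 0 < w₀.re) :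
    DiffContOnCl ℂ (poissonQuotient G w₀) {z | 0 < z.re} := by
  have hmem : {z : ℂ | 0 < z.re} ∈ 𝓝 w₀ := (Complex.isOpen_re_gt 0).mem_nhds hw₀
  have hslope : DiffContOnCl ℂ (dslope G w₀) {z | 0 < z.re} :=
    ⟨(Complex.differentiableOn_dslope hmem).2 hG.1,
      (continuousOn_dslope (mem_of_superset hmem subset_closure)).2
        ⟨hG.2, hG.differentiableAt (Complex.isOpen_re_gt 0) hw₀⟩⟩
  refine DiffContOnCl.smul (DiffContOnCl.inv ?_ fun z hz h0 => ?_) hslope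
  · exact differentiable_id.diffContOnCl.add_const _
  · have hre := congrArg Complex.re h0
    rw [Complex.closure_setOfPred_lt_re] at hz
    rw [Complex.add_re, Complex.conj_re, Complex.zero_re] at hre
    exact (add_pos_of_nonneg_of_pos hz hw₀).ne' hre

theorem norm_sub_le_norm_add_conj {w₀ w : ℂ} (hw₀ : 0 ≤ w₀.re) (hw : 0 ≤ w.re) :
    ‖w - w₀‖ ≤ ‖w + conj w₀‖ := by
  rw [← sq_le_sq₀ (norm_nonneg _) (norm_nonneg _), ← Complex.normSq_eq_norm_sq,
    ← Complex.normSq_eq_norm_sq, Complex.normSq_apply, Complex.normSq_apply]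
  simp only [Complex.sub_re, Complex.sub_im, Complex.add_re, Complex.add_im, Complex.conj_re,
    Complex.conj_im]
  nlinarith [mul_nonneg hw hw₀]

theorem norm_poissonQuotient_le {G : ℂ → E} {C : ℝ} (hC : ∀ z : ℂ, 0 ≤ z.re → ‖G z‖ ≤ C)
    {w₀ w : ℂ} (hw₀ : 0 ≤ w₀.re) (hw : 0 ≤ w.re) {R : ℝ} (hR : 0 < R) (hRw : R ≤ ‖w - w₀‖) :
    ‖poissonQuotient G w₀ w‖ ≤ 2 * C / R ^ 2 := by
  have hne : w ≠ w₀ := sub_ne_zero.1 (norm_pos_iff.1 (hR.trans_le hRw))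
  have hconj : R ≤ ‖w + conj w₀‖ := hRw.trans (norm_sub_le_norm_add_conj hw₀ hw)
  calc ‖poissonQuotient G w₀ w‖
      = ‖w + conj w₀‖⁻¹ * (‖w - w₀‖⁻¹ * ‖G w - G w₀‖) := by
        rw [poissonQuotient, dslope_of_ne _ hne, slope, vsub_eq_sub, norm_smul, norm_smul,
          norm_inv, norm_inv]
    _ ≤ R⁻¹ * (R⁻¹ * (C + C)) := by
        gcongr
        exact norm_sub_le_of_le (hC w hw) (hC w₀ hw₀)
    _ = 2 * C / R ^ 2 := by
        field_simp
        ring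

theorem halfPlanePoisson_smul_sub (G : ℂ → E) {w : ℂ} (hw : 0 < w.re) (s : ℝ) :
    halfPlanePoisson w s • (G (s * Complex.I) - G w) =
      -(w.re / Real.pi) • poissonQuotient G w (s * Complex.I) := by
  have hpos : 0 < (s - w.im) ^ 2 + w.re ^ 2 := by positivity
  have hprod : (s * Complex.I - w) * (s * Complex.I + conj w) =
      -(((s - w.im) ^ 2 + w.re ^ 2 : ℝ) : ℂ) := by
    have hsub := Complex.sub_conj w
    have hmul := Complex.mul_conj w
    rw [Complex.normSq_apply] at hmul
    push_cast at hsub hmul ⊢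
    linear_combination ((s : ℂ) ^ 2 - 2 * s * w.im) * Complex.I_sq - s * Complex.I * hsub - hmul
  have hne : s * Complex.I + conj w ≠ 0 := fun h => by
    rw [h, mul_zero, eq_comm, neg_eq_zero, Complex.ofReal_eq_zero] at hprod
    exact hpos.ne' hprod
  calc halfPlanePoisson w s • (G (s * Complex.I) - G w)
      = halfPlanePoisson w s • ((s * Complex.I - w) * (s * Complex.I + conj w)) •
          poissonQuotient G w (s * Complex.I) := by
        rw [poissonQuotient, smul_smul, mul_inv_cancel_right₀ hne, sub_smul_dslope]
    _ = -(w.re / Real.pi) • poissonQuotient G w (s * Complex.I) := by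
        rw [hprod, ← Complex.ofReal_neg, Complex.coe_smul, smul_smul, halfPlanePoisson_apply hw]
        congr 1
        field_simp

theorem tendsto_intervalIntegral_poissonQuotient [CompleteSpace E] {G : ℂ → E}
    (hG : DiffContOnCl ℂ G {z | 0 < z.re}) {C : ℝ} (hC : ∀ z : ℂ, 0 ≤ z.re → ‖G z‖ ≤ C)
    {w : ℂ} (hw : 0 < w.re) :
    Tendsto (fun R : ℝ => ∫ s in (w.im - R)..(w.im + R), poissonQuotient G w (s * Complex.I))
      atTop (𝓝 0) := by
  have hH := diffContOnCl_poissonQuotient hG hw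
  have hbound : ∀ R : ℝ, 0 < R →
      ‖∫ s in (w.im - R)..(w.im + R), poissonQuotient G w (s * Complex.I)‖ ≤
        2 * C * (4 * R⁻¹ + 2 * w.re * R⁻¹ ^ 2) := fun R hR => by
    have hrect := norm_intervalIntegral_left_side_le (H := poissonQuotient G w) (a := 0)
      (b := w.re + R) (c := w.im - R) (d := w.im + R) (M := 2 * C / R ^ 2) (by positivity)
      (by linarith) (hH.continuousOn.mono ?_) (hH.differentiableOn.mono fun z hz => hz.1.1) ?_
    · refine (le_of_eq_of_le (by simp only [Complex.ofReal_zero, zero_add]) hrect).trans_eq ?_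
      field_simp
      ring
    · rw [Complex.closure_setOfPred_lt_re]
      exact fun z hz => hz.1.1
    · intro z hz hside
      refine norm_poissonQuotient_le hC hw.le hz.1.1 hR ?_
      obtain h | h | h := hside
      · exact le_trans (by simp [h, abs_of_pos hR]) (Complex.abs_re_le_norm _)
      · exact le_trans (by simp [h, abs_of_pos hR]) (Complex.abs_im_le_norm _)
      · exact le_trans (by simp [h, abs_of_pos hR]) (Complex.abs_im_le_norm _)
  refine squeeze_zero_norm' ((eventually_gt_atTop 0).mono hbound) ?_
  have hinv := tendsto_inv_atTop_zero (𝕜 := ℝ)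
  simpa using ((hinv.const_mul 4).add ((hinv.pow 2).const_mul (2 * w.re))).const_mul (2 * C)

theorem poissonIntegral_of_diffContOnCl [CompleteSpace E] {G : ℂ → E}
    (hG : DiffContOnCl ℂ G {z | 0 < z.re}) {C : ℝ} (hC : ∀ z : ℂ, 0 ≤ z.re → ‖G z‖ ≤ C)
    {w : ℂ} (hw : 0 < w.re) : poissonIntegral w (fun s => G (s * Complex.I)) = G w := by
  have hcont : Continuous fun s : ℝ => G (s * Complex.I) :=
    hG.continuousOn.comp_continuous (by fun_prop) fun s => by simp
  have hP := integrable_halfPlanePoisson w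
  have hint : Integrable fun s => halfPlanePoisson w s • G (s * Complex.I) :=
    hP.smul_bdd C hcont.aestronglyMeasurable (Eventually.of_forall fun s => hC _ (by simp))
  have hdiff : ∫ s, halfPlanePoisson w s • (G (s * Complex.I) - G w) = 0 := by
    have hintdiff : Integrable fun s => halfPlanePoisson w s • (G (s * Complex.I) - G w) := by
      simp only [smul_sub]
      exact hint.sub (hP.smul_const (G w))
    refine tendsto_nhds_unique (intervalIntegral_tendsto_integral hintdiff
      (a := fun R => w.im - R) (b := fun R => w.im + R)
      (tendsto_atBot_add_const_left atTop w.im tendsto_neg_atTop_atBot)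
      (tendsto_atTop_add_const_left atTop w.im tendsto_id)) ?_
    simpa only [halfPlanePoisson_smul_sub G hw, intervalIntegral.integral_smul, smul_zero]
      using (tendsto_intervalIntegral_poissonQuotient hG hC hw).const_smul (-(w.re / Real.pi))
  simp only [smul_sub] at hdiff
  rwa [integral_sub hint (hP.smul_const _), integral_smul_const,
    (isProbDensity_halfPlanePoisson hw).2.2, one_smul, sub_eq_zero] at hdiff

end PoissonFormula

namespace IsHardyInf

variable {F : ℂ → ℂ}

theorem diffContOnCl_add_const (hF : IsHardyInf F) {ε : ℝ} (hε : 0 < ε) :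
    DiffContOnCl ℂ (fun z => F (z + ε)) {z | 0 < z.re} := by
  refine DifferentiableOn.diffContOnCl (hF.1.comp (by fun_prop) fun z hz => ?_)
  rw [Complex.closure_setOfPred_lt_re] at hz
  simpa using add_pos_of_nonneg_of_pos hz hε

theorem poissonIntegral_add_const (hF : IsHardyInf F) {ε : ℝ} (hε : 0 < ε) {w : ℂ}
    (hw : 0 < w.re) : poissonIntegral w (fun s => F (s * Complex.I + ε)) = F (w + ε) := by
  obtain ⟨C, hC⟩ := hF.2
  exact poissonIntegral_of_diffContOnCl (hF.diffContOnCl_add_const hε)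
    (fun z hz => hC _ (by simpa using add_pos_of_nonneg_of_pos hz hε)) hw

theorem poissonIntegral_eq (hF : IsHardyInf F) {g : ℝ → ℂ}
    (hg : ∀ᵐ y : ℝ, Tendsto (fun x : ℝ => F (x + y * Complex.I)) (𝓝[>] 0) (𝓝 (g y)))
    {w : ℂ} (hw : 0 < w.re) : poissonIntegral w g = F w := by
  obtain ⟨C, hC⟩ := hF.2
  have hboundary : Tendsto (fun ε : ℝ => poissonIntegral w fun s => F (s * Complex.I + ε))
      (𝓝[>] 0) (𝓝 (poissonIntegral w g)) := by
    refine tendsto_integral_filter_of_dominated_convergence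
      (fun s => |halfPlanePoisson w s| * C) ?_ ?_
      ((integrable_halfPlanePoisson w).abs.mul_const C) ?_
    · filter_upwards [self_mem_nhdsWithin] with ε hε
      have hcont : Continuous fun s : ℝ => F (s * Complex.I + ε) :=
        (hF.diffContOnCl_add_const hε).continuousOn.comp_continuous
          (f := fun s : ℝ => (s * Complex.I : ℂ)) (by fun_prop)
          fun s => by simp
      exact (integrable_halfPlanePoisson w).aestronglyMeasurable.smul hcont.aestronglyMeasurable
    · filter_upwards [self_mem_nhdsWithin] with ε hε
      refine Eventually.of_forall fun s => ?_
      rw [norm_smul, Real.norm_eq_abs]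
      gcongr
      exact hC _ (by simpa using hε)
    · filter_upwards [hg] with s hs
      simpa only [add_comm] using hs.const_smul (halfPlanePoisson w s)
  have hinterior : Tendsto (fun ε : ℝ => F (w + ε)) (𝓝[>] 0) (𝓝 (F w)) := by
    have hF_cont : ContinuousAt F (w + (0 : ℝ)) := by
      rw [Complex.ofReal_zero, add_zero]
      exact (hF.1.differentiableAt ((Complex.isOpen_re_gt 0).mem_nhds hw)).continuousAt
    have hcomp : ContinuousAt (fun ε : ℝ => F (w + ε)) 0 :=
      ContinuousAt.comp (f := fun ε : ℝ => w + ε) hF_cont (by fun_prop)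
    simpa using hcomp.tendsto.mono_left nhdsWithin_le_nhds
  refine tendsto_nhds_unique hboundary (hinterior.congr' ?_)
  filter_upwards [self_mem_nhdsWithin] with ε hε using (hF.poissonIntegral_add_const hε hw).symm

theorem mul {G : ℂ → ℂ} (hF : IsHardyInf F) (hG : IsHardyInf G) : IsHardyInf (F * G) := by
  obtain ⟨C, hC⟩ := hF.2
  obtain ⟨D, hD⟩ := hG.2
  exact ⟨hF.1.mul hG.1, C * D, fun z hz => norm_mul_le_of_le (hC z hz) (hD z hz)⟩

end IsHardyInf

theorem poissonIntegral_mulLInf {φ ψ : LInf} (hφ : φ ∈ HInfBoundary) (hψ : ψ ∈ HInfBoundary)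
    {w : ℂ} (hw : 0 < w.re) :
    poissonIntegral w (mulLInf φ ψ) = poissonIntegral w φ * poissonIntegral w ψ := by
  obtain ⟨F, hF, hφF⟩ := hφ
  obtain ⟨G, hG, hψG⟩ := hψ
  calc poissonIntegral w (mulLInf φ ψ) = poissonIntegral w (φ * ψ : ℝ → ℂ) :=
        poissonIntegral_congr_ae w (MemLp.coeFn_toLp _)
    _ = F w * G w := (hF.mul hG).poissonIntegral_eq
        (by filter_upwards [hφF, hψG] with y hFy hGy using hFy.mul hGy) hw
    _ = poissonIntegral w φ * poissonIntegral w ψ := by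
        rw [hF.poissonIntegral_eq hφF hw, hG.poissonIntegral_eq hψG hw]

theorem corollary4p1 (φ ψ : LInf) (hφ : φ ∈ HInfBoundary) (hψ : ψ ∈ HInfBoundary)
    (α β : ℂ) (hα : AlmostConvergesTo φ α) (hβ : AlmostConvergesTo ψ β) :
    AlmostConvergesTo (mulLInf φ ψ) (α * β) := by
  rw [almostConvergesTo_iff_tendsto_poissonIntegral] at hα hβ ⊢
  refine (hα.mul hβ).congr' ?_
  filter_upwards [tendsto_comap.eventually_gt_atTop 0] with w hw
  exact (poissonIntegral_mulLInf hφ hψ hw).symm
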